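/- Let $\mathbb{N}^{\mathbb{N}}$ be Baire space, with the product of the discrete topologies, and let $2^{\mathbb{N}}=\{0,1\}^{\mathbb{N}}\subseteq\mathbb{N}^{\mathbb{N}}$ be Cantor space. For $P,Q\subseteq\mathbb{N}^{\mathbb{N}}$, $P$ is Medvedev (strongly) reducible to $Q$, $P\le_s Q$, if there is a Turing functional $\Phi$ such that for every $g\in Q$ the function $\Phi(g)$ is total and belongs to $P$; $P$ and $Q$ are Medvedev (strongly) equivalent if $P\le_s Q$ and $Q\le_s P$. A subset of $\mathbb{N}^{\mathbb{N}}$ is $\Pi^0_1$ if it is the set of infinite paths through a computable tree of finite sequences of natural numbers. Theorem. There is a closed, in fact $\Pi^0_1$, set $Q\subseteq\mathbb{N}^{\mathbb{N}}$ that is not Medvedev equivalent to any closed subset $P$ of $2^{\mathbb{N}}$. -/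

import Mathlib

/-- Codes for oracle programs: Kleene's schemata for the partial recursive functions together with
one instruction that queries the oracle. The constructors are those of `Nat.RecursiveIn`, made into
programs so that one program can be run with every oracle. -/
inductive OracleCode : Type
  | zero : OracleCode
  | succ : OracleCode
  | left : OracleCode
  | right : OracleCode
  | oracle : OracleCode
  | pair : OracleCode → OracleCode → OracleCode
  | comp : OracleCode → OracleCode → OracleCode
  | prec : OracleCode → OracleCode → OracleCode
  | rfind : OracleCode → OracleCode

/-- The Turing functional given by an oracle program: `c.eval g` is the partial function
computed by the program `c` with oracle `g`. -/
def OracleCode.eval (c : OracleCode) (g : ℕ → ℕ) : ℕ →. ℕ :=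
  match c with
  | .zero => fun _ => Part.some 0
  | .succ => fun n => Part.some (n + 1)
  | .left => fun n => Part.some n.unpair.1
  | .right => fun n => Part.some n.unpair.2
  | .oracle => fun n => Part.some (g n)
  | .pair c₁ c₂ => fun n => Nat.pair <$> c₁.eval g n <*> c₂.eval g n
  | .comp c₁ c₂ => fun n => c₂.eval g n >>= c₁.eval g
  | .prec c₁ c₂ => fun p =>
      p.unpair.2.rec (c₁.eval g p.unpair.1) fun y IH => do
        let i ← IH
        c₂.eval g (Nat.pair p.unpair.1 (Nat.pair y i))
  | .rfind c₁ => fun a => Nat.rfind fun n => (fun m => decide (m = 0)) <$> c₁.eval g (Nat.pair a n)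

/-- `MedvedevReducible P Q` is `P ≤ₛ Q`: there is a Turing functional `Φ` such that `Φ(g)` is total
and belongs to `P` for every `g ∈ Q`. -/
def MedvedevReducible (P Q : Set (ℕ → ℕ)) : Prop :=
  ∃ c : OracleCode, ∀ g ∈ Q, ∃ f ∈ P, ∀ n, c.eval g n = Part.some (f n)

/-- `P ≡ₛ Q`: Medvedev (strong) equivalence of mass problems. -/
def MedvedevEquivalent (P Q : Set (ℕ → ℕ)) : Prop :=
  MedvedevReducible P Q ∧ MedvedevReducible Q P

/-- Cantor space, as the subspace of Baire space `ℕ → ℕ` (with the product topology) that consists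
of the functions with values in `{0, 1}`. -/
def cantorSpace : Set (ℕ → ℕ) :=
  {f | ∀ n, f n = 0 ∨ f n = 1}

/-- The initial segment `⟨f 0, …, f (n - 1)⟩` of `f`. -/
def initialSegment (f : ℕ → ℕ) (n : ℕ) : List ℕ :=
  (List.range n).map f

/-- A tree is a set of finite sequences that is closed under initial segments. -/
def IsStringTree (T : Set (List ℕ)) : Prop :=
  ∀ σ τ : List ℕ, σ <+: τ → τ ∈ T → σ ∈ T

/-- The set `[T]` of infinite paths through `T`. -/
def treePaths (T : Set (List ℕ)) : Set (ℕ → ℕ) :=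
  {f | ∀ n, initialSegment f n ∈ T}

/-- `P` is a (lightface) `Π⁰₁` subset of Baire space: the set of infinite paths through a
computable tree. -/
def IsPiZeroOne (P : Set (ℕ → ℕ)) : Prop :=
  ∃ T : Set (List ℕ), ComputablePred (fun σ => σ ∈ T) ∧ IsStringTree T ∧ P = treePaths T

/-! `Q` consists of functions `f_m`, where `f_m(0) = m` and the other values record a c.e. set `A_m`
with the stage at which each element enters; recording the stages makes `Q` a `Π⁰₁` set. If `Q` were
equivalent to a closed `P ⊆ 2^ℕ`, compactness (`OracleCode.exists_bound_of_isCompact`) would bound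
by some `B` the first value of the functional `P → Q`, so the composite `Q → P → Q` would send every
`f_x` to some `f_m` with `m ≤ B`.

`not_exists_bounded_functional` diagonalizes with an `x > B` coding the composite and the level `B`.
Once the composite is seen to output `0` at `x + 1` on `f_x`, put `x` into `A_m` for all `m ≤ B`,
hence not into `A_x`, and restrain the oracle values used: the output is preserved and now wrong. If
`x` never acted, `0` would be correct, so it would be seen and `x` would act. No priorities are
needed: only the finitely many restraints set by numbers `≤ B` can block `x`, and a large `x` lies
beyond them. -/

open Filter

/-! ### Finite oracles and the use principle -/

/-- The program `c` run with a partial oracle `p`; queries outside the domain of `p` diverge. -/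
def OracleCode.evalPart (c : OracleCode) (p : ℕ →. ℕ) : ℕ →. ℕ :=
  match c with
  | .zero => fun _ => Part.some 0
  | .succ => fun n => Part.some (n + 1)
  | .left => fun n => Part.some n.unpair.1
  | .right => fun n => Part.some n.unpair.2
  | .oracle => p
  | .pair c₁ c₂ => fun n =>
      (c₁.evalPart p n).bind fun a => (c₂.evalPart p n).map fun b => Nat.pair a b
  | .comp c₁ c₂ => fun n => (c₂.evalPart p n).bind (c₁.evalPart p)
  | .prec c₁ c₂ => fun q =>
      q.unpair.2.rec (c₁.evalPart p q.unpair.1) fun y IH =>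
        IH.bind fun i => c₂.evalPart p (Nat.pair q.unpair.1 (Nat.pair y i))
  | .rfind c₁ => fun a =>
      Nat.rfind fun n => (c₁.evalPart p (Nat.pair a n)).map fun m => decide (m = 0)

/-- The finite partial oracle given by a finite sequence. -/
def listOracle (σ : List ℕ) : ℕ →. ℕ := fun n => Part.ofOption σ[n]?

theorem OracleCode.evalPart_total (c : OracleCode) (g : ℕ → ℕ) :
    c.evalPart (fun n => Part.some (g n)) = c.eval g := by
  induction c with
  | pair c₁ c₂ h₁ h₂ =>
    funext n
    simp [evalPart, eval, h₁, h₂, Seq.seq, Part.bind_map]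
  | comp c₁ c₂ h₁ h₂ => simp only [evalPart, eval, h₁, h₂]; rfl
  | prec c₁ c₂ h₁ h₂ => funext n; simp [evalPart, eval, h₁, h₂]
  | rfind c h => funext n; simp [evalPart, eval, h]
  | _ => rfl

theorem OracleCode.evalPart_mono (c : OracleCode) {p q : ℕ →. ℕ}
    (hpq : ∀ n, ∀ v ∈ p n, v ∈ q n) : ∀ n, ∀ v ∈ c.evalPart p n, v ∈ c.evalPart q n := by
  induction c with
  | oracle => exact hpq
  | pair c₁ c₂ h₁ h₂ =>
    intro n v
    simp only [evalPart, Part.mem_bind_iff, Part.mem_map_iff]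
    rintro ⟨a, ha, b, hb, rfl⟩
    exact ⟨a, h₁ _ _ ha, b, h₂ _ _ hb, rfl⟩
  | comp c₁ c₂ h₁ h₂ =>
    intro n v h
    obtain ⟨a, ha, hv⟩ := Part.mem_bind_iff.1 h
    exact Part.mem_bind_iff.2 ⟨a, h₂ _ _ ha, h₁ _ _ hv⟩
  | prec c₁ c₂ h₁ h₂ =>
    intro n
    simp only [evalPart]
    generalize n.unpair.2 = y
    induction y with
    | zero => exact h₁ _
    | succ y ih =>
      intro v
      simp only [Part.mem_bind_iff]
      rintro ⟨a, ha, hv⟩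
      exact ⟨a, ih _ ha, h₂ _ _ hv⟩
  | rfind c h =>
    intro n v hn
    obtain ⟨hv, hlt⟩ := Nat.mem_rfind.1 hn
    obtain ⟨a, ha, ha'⟩ := (Part.mem_map_iff _).1 hv
    refine Nat.mem_rfind.2 ⟨(Part.mem_map_iff _).2 ⟨a, h _ _ ha, ha'⟩, fun {m} hm => ?_⟩
    obtain ⟨b, hb, hb'⟩ := (Part.mem_map_iff _).1 (hlt hm)
    exact (Part.mem_map_iff _).2 ⟨b, h _ _ hb, hb'⟩
  | _ => exact fun _ _ h => h

theorem listOracle_initialSegment {g : ℕ → ℕ} {k n v : ℕ} :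
    v ∈ listOracle (initialSegment g k) n ↔ n < k ∧ v = g n := by
  rw [listOracle, Part.mem_ofOption, initialSegment, List.getElem?_map]
  by_cases h : n < k <;> simp [h, eq_comm]

/-- A computation from a finite part of the oracle is a computation from the oracle. -/
theorem OracleCode.mem_eval_of_initialSegment {c : OracleCode} {g : ℕ → ℕ} {k n v : ℕ}
    (h : v ∈ c.evalPart (listOracle (initialSegment g k)) n) : v ∈ c.eval g n := by
  rw [← evalPart_total]
  refine c.evalPart_mono (fun m w hw => ?_) n v h
  simpa using (listOracle_initialSegment.1 hw).2

/-- A computation uses only finitely many values of the oracle. -/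
theorem OracleCode.eventually_mem_evalPart (c : OracleCode) (g : ℕ → ℕ) :
    ∀ n, ∀ v ∈ c.eval g n,
      ∀ᶠ k in atTop, v ∈ c.evalPart (listOracle (initialSegment g k)) n := by
  rw [← evalPart_total]
  induction c with
  | oracle =>
    intro n v hv
    filter_upwards [eventually_gt_atTop n] with k hk
    exact listOracle_initialSegment.2 ⟨hk, by simpa [evalPart] using hv⟩
  | pair c₁ c₂ h₁ h₂ =>
    intro n v
    simp only [evalPart, Part.mem_bind_iff, Part.mem_map_iff]
    rintro ⟨a, ha, b, hb, rfl⟩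
    filter_upwards [h₁ _ _ ha, h₂ _ _ hb] with k hka hkb
    exact ⟨a, hka, b, hkb, rfl⟩
  | comp c₁ c₂ h₁ h₂ =>
    intro n v h
    obtain ⟨a, ha, hv⟩ := Part.mem_bind_iff.1 h
    filter_upwards [h₂ _ _ ha, h₁ _ _ hv] with k hka hkv
    exact Part.mem_bind_iff.2 ⟨a, hka, hkv⟩
  | prec c₁ c₂ h₁ h₂ =>
    intro n
    simp only [evalPart]
    generalize n.unpair.2 = y
    induction y with
    | zero => exact h₁ _
    | succ y ih =>
      intro v
      simp only [Part.mem_bind_iff]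
      rintro ⟨a, ha, hv⟩
      filter_upwards [ih _ ha, h₂ _ _ hv] with k hka hkv
      exact ⟨a, hka, hkv⟩
  | rfind c h =>
    intro n v hn
    obtain ⟨hv, hlt⟩ := Nat.mem_rfind.1 hn
    obtain ⟨a, ha, ha'⟩ := (Part.mem_map_iff _).1 hv
    have hall : ∀ᶠ k in atTop, ∀ m ∈ Set.Iio v, ∃ b ∈ c.evalPart
        (listOracle (initialSegment g k)) (Nat.pair n m), decide (b = 0) = false := by
      refine ((Set.finite_Iio v).eventually_all).2 fun m hm => ?_
      obtain ⟨b, hb, hb'⟩ := (Part.mem_map_iff _).1 (hlt hm)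
      filter_upwards [h _ _ hb] with k hk
      exact ⟨b, hk, hb'⟩
    filter_upwards [h _ _ ha, hall] with k hka hk
    exact Nat.mem_rfind.2 ⟨(Part.mem_map_iff _).2 ⟨a, hka, ha'⟩,
      fun {m} hm => (Part.mem_map_iff _).2 (hk m hm)⟩
  | _ => exact fun _ _ h => Eventually.of_forall fun _ => h

/-- Running a fixed program from a finite oracle is partial recursive in the finite oracle. -/
theorem OracleCode.partrec_evalPart (c : OracleCode) :
    Partrec₂ fun (σ : List ℕ) (n : ℕ) => c.evalPart (listOracle σ) n := by
  induction c with
  | zero => exact (Computable.const (α := List ℕ × ℕ) 0).partrec.to₂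
  | succ => exact (Computable.succ.comp Computable.snd).partrec.to₂
  | left => exact (Computable.fst.comp (Computable.unpair.comp Computable.snd)).partrec.to₂
  | right => exact (Computable.snd.comp (Computable.unpair.comp Computable.snd)).partrec.to₂
  | oracle =>
    exact (Computable.list_getElem?.comp Computable.fst Computable.snd).ofOption.to₂
  | pair c₁ c₂ h₁ h₂ =>
    exact (Partrec.bind h₁ (Partrec.map (h₂.comp₂ (Computable.fst.comp Computable.fst).to₂
      (Computable.snd.comp Computable.fst).to₂)
      (Primrec₂.natPair.to_comp.comp (Computable.snd.comp Computable.fst)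
        Computable.snd).to₂).to₂).to₂
  | comp c₁ c₂ h₁ h₂ =>
    exact (Partrec.bind (g := fun (a : List ℕ × ℕ) b => c₁.evalPart (listOracle a.1) b) h₂
      (h₁.comp (Computable.fst.comp Computable.fst) Computable.snd).to₂).to₂
  | prec c₁ c₂ h₁ h₂ =>
    have hu : Computable fun a : List ℕ × ℕ => a.2.unpair :=
      Computable.unpair.comp Computable.snd
    refine (Partrec.nat_rec (Computable.snd.comp hu)
      (h₁.comp Computable.fst (Computable.fst.comp hu)) (h := fun a b =>
        c₂.evalPart (listOracle a.1) (Nat.pair a.2.unpair.1 (Nat.pair b.1 b.2))) ?_).to₂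
    exact (h₂.comp (Computable.fst.comp Computable.fst)
      (Primrec₂.natPair.to_comp.comp (Computable.fst.comp (hu.comp Computable.fst))
        (Primrec₂.natPair.to_comp.comp (Computable.fst.comp Computable.snd)
          (Computable.snd.comp Computable.snd)))).to₂
  | rfind c h =>
    refine (Partrec.rfind (p := fun (a : List ℕ × ℕ) n =>
      (c.evalPart (listOracle a.1) (Nat.pair a.2 n)).map fun m => decide (m = 0)) ?_).to₂
    refine (Partrec.map (g := fun _ m => decide (m = 0)) (h.comp (Computable.fst.comp Computable.fst)
      (Primrec₂.natPair.to_comp.comp (Computable.snd.comp Computable.fst) Computable.snd)) ?_).to₂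
    exact (Primrec.eq.decide.comp Primrec.snd (Primrec.const 0)).to_comp.to₂

/-- Lets stages of the construction simulate the functional by the time-bounded `evaln`. -/
theorem OracleCode.exists_code (c : OracleCode) : ∃ e : Nat.Partrec.Code, ∀ σ n v,
    v ∈ e.eval (Encodable.encode (σ, n)) ↔ v ∈ c.evalPart (listOracle σ) n := by
  obtain ⟨e, he⟩ := Nat.Partrec.Code.exists_code.1 c.partrec_evalPart
  refine ⟨e, fun σ n v => ?_⟩
  simp [he]

/-- The program that runs `c` with the oracle computed by `d`. -/
def OracleCode.subst (c d : OracleCode) : OracleCode :=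
  match c with
  | .oracle => d
  | .pair c₁ c₂ => .pair (c₁.subst d) (c₂.subst d)
  | .comp c₁ c₂ => .comp (c₁.subst d) (c₂.subst d)
  | .prec c₁ c₂ => .prec (c₁.subst d) (c₂.subst d)
  | .rfind c => .rfind (c.subst d)
  | c => c

theorem OracleCode.eval_subst (c : OracleCode) {d : OracleCode} {g f : ℕ → ℕ}
    (h : ∀ n, d.eval g n = Part.some (f n)) : (c.subst d).eval g = c.eval f := by
  induction c with
  | oracle => exact funext h
  | _ => simp only [subst, eval, *]; rfl

/-! ### The enumeration with restraints -/

namespace RestrainedEnumeration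

/-! A stage `s` codes a number `req s` together with an oracle bound `use s` and a time bound
`time s`; a number `x` codes a program `code x` and a level `level x`, and may be enumerated into
the sets `A_m` with `m ≤ level x`. -/

def req (s : ℕ) : ℕ := s.unpair.1

def use (s : ℕ) : ℕ := s.unpair.2.unpair.1

def time (s : ℕ) : ℕ := s.unpair.2.unpair.2

def code (x : ℕ) : Nat.Partrec.Code := Denumerable.ofNat Nat.Partrec.Code x.unpair.1

def level (x : ℕ) : ℕ := x.unpair.2.unpair.1

/-- The function `f_m` given by the list `L` of acting stages: it records `m`, and then for each `y`
the successor of the stage at which `y` enters `A_m`, or `0`. -/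
def value (L : List ℕ) (m i : ℕ) : ℕ :=
  Nat.casesOn i m fun y =>
    if m ≤ level y then L.foldr (fun t v => if req t = y then t + 1 else v) 0 else 0

/-- The stage `s` acts for `req s` after the acting stages in `L`: `req s` has not been treated, it
respects the earlier restraints, and the program `code (req s)` is seen to output `0` at
`req s + 1`. -/
def Ready (L : List ℕ) (s : ℕ) : Prop :=
  (∀ t ∈ L, req t ≠ req s ∧ (level (req s) < req t ∨ use t ≤ req s)) ∧
    Nat.Partrec.Code.evaln (time s) (code (req s))
      (Encodable.encode ((List.range (use s)).map (value L (req s)), req s + 1)) = some 0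

instance (L : List ℕ) (s : ℕ) : Decidable (Ready L s) := inferInstanceAs (Decidable (_ ∧ _))

/-- The list of acting stages below `s`. -/
def history (s : ℕ) : List ℕ :=
  Nat.rec [] (fun t L => if Ready L t then t :: L else L) s

def Acts (s : ℕ) : Prop := Ready (history s) s

section Computability

theorem primrec_req : Primrec req := Primrec.fst.comp Primrec.unpair

theorem primrec_use : Primrec use :=
  Primrec.fst.comp (Primrec.unpair.comp (Primrec.snd.comp Primrec.unpair))

theorem primrec_time : Primrec time :=
  Primrec.snd.comp (Primrec.unpair.comp (Primrec.snd.comp Primrec.unpair))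

theorem primrec_code : Primrec code :=
  (Primrec.ofNat Nat.Partrec.Code).comp (Primrec.fst.comp Primrec.unpair)

theorem primrec_level : Primrec level :=
  Primrec.fst.comp (Primrec.unpair.comp (Primrec.snd.comp Primrec.unpair))

theorem primrec_value : Primrec fun a : (List ℕ × ℕ) × ℕ => value a.1.1 a.1.2 a.2 := by
  have hfold : Primrec fun b : ((List ℕ × ℕ) × ℕ) × ℕ =>
      b.1.1.1.foldr (fun t v => if req t = b.2 then t + 1 else v) 0 := by
    refine Primrec.list_foldr (f := fun b : ((List ℕ × ℕ) × ℕ) × ℕ => b.1.1.1) (h := fun b (c : ℕ × ℕ) => if req c.1 = b.2 then c.1 + 1 else c.2)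
      (Primrec.fst.comp (Primrec.fst.comp Primrec.fst)) (Primrec.const 0) ?_
    exact (Primrec.ite (Primrec.eq.comp (primrec_req.comp (Primrec.fst.comp Primrec.snd))
      (Primrec.snd.comp Primrec.fst)) (Primrec.succ.comp (Primrec.fst.comp Primrec.snd))
      (Primrec.snd.comp Primrec.snd)).to₂
  refine Primrec.nat_casesOn (h := fun (a : (List ℕ × ℕ) × ℕ) y =>
      if a.1.2 ≤ level y then a.1.1.foldr (fun t v => if req t = y then t + 1 else v) 0 else 0)
    Primrec.snd (Primrec.snd.comp Primrec.fst) ?_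
  exact (Primrec.ite (Primrec.nat_le.comp (Primrec.snd.comp (Primrec.fst.comp Primrec.fst))
    (primrec_level.comp Primrec.snd)) hfold (Primrec.const 0)).to₂

theorem primrec_ready : PrimrecRel Ready := by
  have hr : Primrec fun a : List ℕ × ℕ => req a.2 := primrec_req.comp Primrec.snd
  have hvals : Primrec fun a : List ℕ × ℕ => (List.range (use a.2)).map (value a.1 (req a.2)) :=
    Primrec.list_map (g := fun (a : List ℕ × ℕ) i => value a.1 (req a.2) i)
      (Primrec.list_range.comp (primrec_use.comp Primrec.snd))
      (primrec_value.comp (Primrec.pair (Primrec.pair (Primrec.fst.comp Primrec.fst)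
        (hr.comp Primrec.fst)) Primrec.snd)).to₂
  have hR : PrimrecRel fun t s => req t ≠ req s ∧ (level (req s) < req t ∨ use t ≤ req s) :=
    ((Primrec.eq.comp (primrec_req.comp Primrec.fst) (primrec_req.comp Primrec.snd)).not).and
      ((Primrec.nat_lt.comp (primrec_level.comp (primrec_req.comp Primrec.snd))
        (primrec_req.comp Primrec.fst)).or
        (Primrec.nat_le.comp (primrec_use.comp Primrec.fst) (primrec_req.comp Primrec.snd)))
  refine PrimrecPred.and hR.forall_mem_list (Primrec.eq.comp ?_ (Primrec.const _))
  exact Nat.Partrec.Code.primrec_evaln.comp (Primrec.pair (Primrec.pair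
    (primrec_time.comp Primrec.snd) (primrec_code.comp hr))
    (Primrec.encode.comp (Primrec.pair hvals (Primrec.succ.comp hr))))

theorem primrec_history : Primrec history := by
  refine Primrec.nat_rec₁ (f := fun t L => if Ready L t then t :: L else L) [] ?_
  exact (Primrec.ite (primrec_ready.comp Primrec.snd Primrec.fst)
    (Primrec.list_cons.comp Primrec.fst Primrec.snd) Primrec.snd).to₂

end Computability

/-! ### `Q` as the paths of a computable tree -/

/-- The tree whose paths are the functions `f_m`. -/
def tree : Set (List ℕ) :=
  {σ | σ = (List.range σ.length).map (value (history (σ.length + σ.sum)) σ.headI)}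

theorem computablePred_tree : ComputablePred fun σ => σ ∈ tree := by
  have hsum : Primrec fun σ : List ℕ => σ.sum :=
    Primrec.list_foldr (h := fun _ (c : ℕ × ℕ) => c.1 + c.2) Primrec.id (Primrec.const 0)
      (Primrec.nat_add.comp (Primrec.fst.comp Primrec.snd) (Primrec.snd.comp Primrec.snd)).to₂
  refine PrimrecPred.computablePred (Primrec.eq.comp Primrec.id ?_)
  exact Primrec.list_map (g := fun (σ : List ℕ) i =>
      value (history (σ.length + σ.sum)) σ.headI i)
    (Primrec.list_range.comp Primrec.list_length)
    (primrec_value.comp (Primrec.pair (Primrec.pair (primrec_history.comp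
      (Primrec.nat_add.comp (Primrec.list_length.comp Primrec.fst) (hsum.comp Primrec.fst)))
      (Primrec.list_headI.comp Primrec.fst)) Primrec.snd)).to₂

theorem mem_history {s t : ℕ} : t ∈ history s ↔ t < s ∧ Acts t := by
  induction s with
  | zero => simp [history]
  | succ s ih =>
    have hs : history (s + 1) = if Ready (history s) s then s :: history s else history s := rfl
    rw [hs]
    split_ifs with h
    · rw [List.mem_cons, ih]
      constructor
      · rintro (rfl | ⟨h1, h2⟩)
        exacts [⟨Nat.lt_succ_self _, h⟩, ⟨by omega, h2⟩]
      · rintro ⟨h1, h2⟩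
        by_cases hts : t = s
        exacts [Or.inl hts, Or.inr ⟨by omega, h2⟩]
    · rw [ih]
      refine ⟨fun ⟨h1, h2⟩ => ⟨by omega, h2⟩, fun ⟨h1, h2⟩ => ⟨?_, h2⟩⟩
      have : t ≠ s := by rintro rfl; exact h h2
      omega

theorem acts_injective {s t : ℕ} (hs : Acts s) (ht : Acts t) (h : req s = req t) : s = t := by
  rcases lt_trichotomy s t with hlt | heq | hlt
  · exact absurd h (ht.1 s (mem_history.2 ⟨hlt, hs⟩)).1
  · exact heq
  · exact absurd h.symm (hs.1 t (mem_history.2 ⟨hlt, ht⟩)).1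

theorem value_succ_eq_succ {s m y t : ℕ} : value (history s) m (y + 1) = t + 1 ↔
    m ≤ level y ∧ t < s ∧ Acts t ∧ req t = y := by
  have hfold : ∀ L : List ℕ, (∀ u ∈ L, Acts u) →
      (L.foldr (fun t v => if req t = y then t + 1 else v) 0 = t + 1 ↔ t ∈ L ∧ req t = y) := by
    intro L hL
    induction L with
    | nil => simp
    | cons u L ih =>
      rw [List.foldr_cons]
      split_ifs with h
      · rw [Nat.succ_inj]
        constructor
        · rintro rfl
          exact ⟨List.mem_cons_self, h⟩
        · rintro ⟨h1, h2⟩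
          rcases List.mem_cons.1 h1 with rfl | h3
          · rfl
          · exact acts_injective (hL u List.mem_cons_self) (hL t h1) (h.trans h2.symm)
      · rw [ih fun w hw => hL w (List.mem_cons_of_mem _ hw), List.mem_cons]
        refine and_congr_left fun h2 => ⟨Or.inr, ?_⟩
        rintro (rfl | h3)
        exacts [absurd h2 h, h3]
  change (if m ≤ level y then _ else 0) = _ ↔ _
  split_ifs with h
  · rw [hfold _ fun u hu => (mem_history.1 hu).2, mem_history]
    tauto
  · simp [h]

open Classical in
/-- The function `f_m`. -/
noncomputable def limit (m i : ℕ) : ℕ :=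
  Nat.casesOn i m fun y =>
    if h : m ≤ level y ∧ ∃ t, Acts t ∧ req t = y then h.2.choose + 1 else 0

@[simp] theorem limit_zero (m : ℕ) : limit m 0 = m := rfl

theorem limit_succ_eq_succ {m y t : ℕ} : limit m (y + 1) = t + 1 ↔
    m ≤ level y ∧ Acts t ∧ req t = y := by
  by_cases h : m ≤ level y ∧ ∃ t, Acts t ∧ req t = y
  · have hc := h.2.choose_spec
    have hl : limit m (y + 1) = h.2.choose + 1 := dif_pos h
    rw [hl, Nat.succ_inj]
    constructor
    · intro heq
      exact ⟨h.1, heq ▸ hc⟩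
    · rintro ⟨-, h1, h2⟩
      exact acts_injective hc.1 h1 (hc.2.trans h2.symm)
  · have hl : limit m (y + 1) = 0 := dif_neg h
    refine iff_of_false (by omega) ?_
    rintro ⟨h1, h2⟩
    exact h ⟨h1, t, h2⟩

theorem value_eq_limit {s m i : ℕ} (h : limit m i ≤ s) : value (history s) m i = limit m i := by
  cases i with
  | zero => rfl
  | succ y =>
    rcases hv : limit m (y + 1) with - | t
    · rcases hw : value (history s) m (y + 1) with - | t
      · rfl
      · have h1 := value_succ_eq_succ.1 hw
        rw [limit_succ_eq_succ.2 ⟨h1.1, h1.2.2⟩] at hv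
        omega
    · have h1 := limit_succ_eq_succ.1 hv
      exact value_succ_eq_succ.2 ⟨h1.1, by omega, h1.2⟩

/-- A nonzero entry `t + 1 ≤ s'` stems from a stage `t < s'`, and a zero was zero at all earlier
stages. -/
theorem value_eq_of_le {s s' m i : ℕ} (hs : s' ≤ s) (h : value (history s) m i ≤ s') :
    value (history s') m i = value (history s) m i := by
  cases i with
  | zero => rfl
  | succ y =>
    rcases hv : value (history s) m (y + 1) with - | t
    · rcases hw : value (history s') m (y + 1) with - | t
      · rfl
      · have h1 := value_succ_eq_succ.1 hw
        rw [value_succ_eq_succ.2 ⟨h1.1, by omega, h1.2.2⟩] at hv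
        omega
    · have h1 := value_succ_eq_succ.1 hv
      exact value_succ_eq_succ.2 ⟨h1.1, by omega, h1.2.2⟩

theorem mem_tree_iff {σ : List ℕ} : σ ∈ tree ↔ ∀ (i : ℕ) (h : i < σ.length),
    value (history (σ.length + σ.sum)) σ.headI i = σ[i] := by
  rw [tree, Set.mem_ofPred_eq, List.ext_getElem_iff]
  simp [eq_comm]

theorem isStringTree_tree : IsStringTree tree := by
  rintro σ τ ⟨ρ, rfl⟩ hτ
  rw [mem_tree_iff] at hτ ⊢
  intro i hi
  have h := hτ i (by simp; omega)
  have hhead : (σ ++ ρ).headI = σ.headI := by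
    cases σ with
    | nil => simp at hi
    | cons => rfl
  rw [List.getElem_append_left hi, hhead] at h
  rw [← h]
  refine value_eq_of_le (by simp; omega) ?_
  rw [h]
  exact (List.single_le_sum (by simp) _ (List.getElem_mem hi)).trans (Nat.le_add_left _ _)

/-- The sum in the stage bound reaches every recorded stage, so true segments are accepted; the
length makes the bound grow, so a false zero is eventually rejected. -/
theorem treePaths_tree : treePaths tree = Set.range limit := by
  have hlen (f : ℕ → ℕ) (n : ℕ) : (initialSegment f n).length = n := by simp [initialSegment]
  have hget (f : ℕ → ℕ) (n i : ℕ) (h : i < (initialSegment f n).length) :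
      (initialSegment f n)[i] = f i := by simp [initialSegment]
  have hhead (f : ℕ → ℕ) (n : ℕ) (h : 0 < n) : (initialSegment f n).headI = f 0 := by
    obtain ⟨n, rfl⟩ := Nat.exists_eq_succ_of_ne_zero h.ne'
    simp [initialSegment, List.range_succ_eq_map]
  ext f
  constructor
  · intro hf
    refine ⟨f 0, funext fun i => ?_⟩
    set n := i + 1 + limit (f 0) i with hn
    have h := mem_tree_iff.1 (hf n) i (by rw [hlen]; omega)
    rw [hget, hhead _ _ (by omega), hlen] at h
    rw [← h, value_eq_limit (by omega)]
  · rintro ⟨m, rfl⟩ n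
    rw [mem_tree_iff]
    intro i hi
    rw [hget, hhead _ _ (by rw [hlen] at hi; omega), limit_zero]
    refine value_eq_limit ?_
    rw [← hget (limit m) n i hi]
    exact (List.single_le_sum (by simp) _ (List.getElem_mem hi)).trans (Nat.le_add_left _ _)

theorem isClosed_treePaths (T : Set (List ℕ)) : IsClosed (treePaths T) := by
  have hT : treePaths T =
      ⋂ n, (fun (f : ℕ → ℕ) (i : Fin n) => f i) ⁻¹' {v | List.ofFn v ∈ T} := by
    ext f
    simp [treePaths, initialSegment, List.ofFn_eq_map, ← List.map_coe_finRange_eq_range,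
      Function.comp_def]
  rw [hT]
  exact isClosed_iInter fun n => (isClosed_discrete _).preimage (by fun_prop)

/-! ### Diagonalization -/

/-- The oracle used by an acting stage is preserved. -/
theorem map_value_eq_initialSegment {t : ℕ} (ht : Acts t) (hlevel : level (req t) < req t) :
    (List.range (use t)).map (value (history t) (req t)) =
      initialSegment (limit (req t)) (use t) := by
  refine List.map_congr_left fun i hi => ?_
  rw [List.mem_range] at hi
  cases i with
  | zero => rfl
  | succ y =>
    rcases hv : limit (req t) (y + 1) with - | u
    · rw [value_eq_limit (by omega), hv]
    · obtain ⟨h1, h2, rfl⟩ := limit_succ_eq_succ.1 hv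
      refine value_succ_eq_succ.2 ⟨h1, ?_, h2, rfl⟩
      by_contra! htu
      -- A later actor obeys the restraint of `t`; `t` itself stays out of its own oracle because
      -- `level (req t) < req t`.
      rcases htu.lt_or_eq with hlt | rfl
      · have := (h2.1 t (mem_history.2 ⟨hlt, ht⟩)).2
        omega
      · omega

/-- Each number acts at most once, so finitely many stages are concerned. -/
theorem exists_use_bound (B : ℕ) : ∃ b, ∀ t, Acts t → req t ≤ B → use t ≤ b := by
  have hfin : {t | Acts t ∧ req t ≤ B}.Finite :=
    Set.Finite.of_injOn (f := req) (t := Set.Iic B) (fun t ht => ht.2)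
      (fun s hs t ht h => acts_injective hs.1 ht.1 h) (Set.finite_Iic B)
  obtain ⟨b, hb⟩ := (hfin.image use).bddAbove
  exact ⟨b, fun t h1 h2 => hb ⟨t, ⟨h1, h2⟩, rfl⟩⟩

/-- No Turing functional maps every `f_x` into a fixed finite set of functions `f_m`. -/
theorem not_exists_bounded_functional (c : OracleCode) (B : ℕ) :
    ¬ ∀ x, ∃ m ≤ B, ∀ n, c.eval (limit x) n = Part.some (limit m n) := by
  intro hc
  obtain ⟨e, he⟩ := c.exists_code
  obtain ⟨b, hb⟩ := exists_use_bound B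
  -- The last component only serves to make `x` exceed both `B` and `b`.
  set x := Nat.pair (Encodable.encode e) (Nat.pair B (b + B + 1)) with hx
  have hcode : code x = e := by simp [code, hx]
  have hlevel : level x = B := by simp [level, hx]
  have hxb : b + B + 1 ≤ x := (Nat.right_le_pair _ _).trans (Nat.right_le_pair _ _)
  obtain ⟨m, hm, hcm⟩ := hc x
  by_cases hex : ∃ t, Acts t ∧ req t = x
  · obtain ⟨t, ht, htx⟩ := hex
    have hev := Nat.Partrec.Code.evaln_sound ht.2
    rw [map_value_eq_initialSegment ht (by rw [htx]; omega), htx, hcode, he] at hev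
    have h0 := OracleCode.mem_eval_of_initialSegment hev
    rw [hcm, limit_succ_eq_succ.2 ⟨by omega, ht, htx⟩] at h0
    simp at h0
  · have hmx : limit m (x + 1) = 0 := by
      rcases hv : limit m (x + 1) with - | t
      · rfl
      · exact absurd ⟨t, (limit_succ_eq_succ.1 hv).2⟩ hex
    obtain ⟨l, hl⟩ := (c.eventually_mem_evalPart (limit x) (x + 1) 0
      (by rw [hcm, hmx]; exact Part.mem_some 0)).exists
    obtain ⟨k, hk⟩ := Nat.Partrec.Code.evaln_complete.1 ((he _ _ _).2 hl)
    -- Time `N` suffices for the simulation and, as `N ≤ s`, stage `s` is late enough for `f_x` to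
    -- have settled below `l`.
    set N := k + ∑ i ∈ Finset.range l, limit x i with hN
    set s := Nat.pair x (Nat.pair l N) with hs
    have hreq : req s = x := by simp [req, hs]
    have huse : use s = l := by simp [use, hs]
    have htime : time s = N := by simp [time, hs]
    have hNs : N ≤ s := (Nat.right_le_pair _ _).trans (Nat.right_le_pair _ _)
    refine hex ⟨s, ⟨fun t ht => ?_, ?_⟩, hreq⟩
    · have ht := (mem_history.1 ht).2
      refine ⟨fun h => hex ⟨t, ht, h.trans hreq⟩, ?_⟩
      rw [hreq, hlevel]
      -- A blocking restraint has `req t ≤ B`, hence use at most `b < x`.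
      by_contra! h
      have := hb t ht h.1
      omega
    · have hmap : (List.range l).map (value (history s) x) = initialSegment (limit x) l := by
        refine List.map_congr_left fun i hi => value_eq_limit ?_
        have := Finset.single_le_sum (f := limit x) (fun _ _ => Nat.zero_le _)
          (Finset.mem_range.2 (List.mem_range.1 hi))
        omega
      rw [hreq, huse, htime, hcode, hmap]
      exact Nat.Partrec.Code.evaln_mono (by omega) hk

end RestrainedEnumeration

/-! ### Compactness and conclusion -/

theorem isCompact_of_isClosed_of_subset_cantorSpace {P : Set (ℕ → ℕ)} (hP : IsClosed P)
    (h : P ⊆ cantorSpace) : IsCompact P := by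
  refine (isCompact_univ_pi fun _ : ℕ => (Set.toFinite ({0, 1} : Set ℕ)).isCompact).of_isClosed_subset
    hP fun f hf n _ => ?_
  simpa using h hf n

/-- A Turing functional that is defined at `n` on a compact set is bounded there. -/
theorem OracleCode.exists_bound_of_isCompact (c : OracleCode) {P : Set (ℕ → ℕ)} (hP : IsCompact P)
    (n : ℕ) (h : ∀ g ∈ P, (c.eval g n).Dom) : ∃ B, ∀ g ∈ P, ∀ v ∈ c.eval g n, v ≤ B := by
  refine hP.induction_on (p := fun S => ∃ B, ∀ g ∈ S, ∀ v ∈ c.eval g n, v ≤ B) ⟨0, by simp⟩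
    (fun S T hST ⟨B, hB⟩ => ⟨B, fun g hg => hB g (hST hg)⟩) ?_ fun g hg => ?_
  · rintro S T ⟨B, hB⟩ ⟨C, hC⟩
    refine ⟨max B C, fun g hg v hv => ?_⟩
    rcases hg with hg | hg
    exacts [(hB g hg v hv).trans (le_max_left _ _), (hC g hg v hv).trans (le_max_right _ _)]
  · obtain ⟨v, hv⟩ := Part.dom_iff_mem.1 (h g hg)
    obtain ⟨k, hk⟩ := (c.eventually_mem_evalPart g n v hv).exists
    -- The computation reads `g` only below `k`, so its value is constant on this neighbourhood.
    have hU : {f : ℕ → ℕ | ∀ i ∈ Set.Iio k, f i = g i} ∈ nhds g := by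
      refine (Filter.eventually_all_finite (Set.finite_Iio k)).2 fun i _ => ?_
      exact (continuous_apply i).continuousAt.eventually (by simp : ∀ᶠ a in nhds (g i), a = g i)
    refine ⟨_, mem_nhdsWithin_of_mem_nhds hU, v, fun f hf w hw => ?_⟩
    have hfg : initialSegment f k = initialSegment g k :=
      List.map_congr_left fun i hi => hf i (List.mem_range.1 hi)
    rw [← hfg] at hk
    exact (Part.mem_unique hw (OracleCode.mem_eval_of_initialSegment hk)).le

open RestrainedEnumeration in
theorem mainTheorem1 :
    ∃ Q : Set (ℕ → ℕ), IsClosed Q ∧ IsPiZeroOne Q ∧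
      ∀ P : Set (ℕ → ℕ), IsClosed P → P ⊆ cantorSpace → ¬ MedvedevEquivalent Q P := by
  refine ⟨treePaths tree, isClosed_treePaths _,
    ⟨tree, computablePred_tree, isStringTree_tree, rfl⟩, ?_⟩
  rintro P hP hPC ⟨⟨c, hc⟩, ⟨d, hd⟩⟩
  -- Coordinate `0` of `f_m` is `m`, so a bound there bounds the index.
  obtain ⟨B, hB⟩ := c.exists_bound_of_isCompact
    (isCompact_of_isClosed_of_subset_cantorSpace hP hPC) 0 fun g hg => by
      obtain ⟨f, -, hf⟩ := hc g hg
      rw [hf]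
      trivial
  rw [treePaths_tree] at hc hd
  refine not_exists_bounded_functional (c.subst d) B fun x => ?_
  obtain ⟨g, hg, hdg⟩ := hd (limit x) ⟨x, rfl⟩
  obtain ⟨_, ⟨m, rfl⟩, hcm⟩ := hc g hg
  refine ⟨m, hB g hg m (by simp [hcm]), fun n => ?_⟩
  rw [c.eval_subst hdg, hcm]
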